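/- Write $\mathrm{PV}\int_{\mathbb R^2} g(y)\,dy=\lim_{r\to0^+,\,R\to\infty}\int_{r<|y|<R}g(y)\,dy$. Let $k\ge 4$ be an integer, $f_0\in H^k(\mathbb R^2)$ real-valued, $\alpha\in[0,1)$, $\varepsilon\in(0,1+\alpha)$ and $T>0$. Let $f\in C^1([0,T];H^k(\mathbb R^2))$ be a real-valued solution on $[0,T]$ of the generalised $\alpha$-Muskat problem $$\frac{\partial f}{\partial t}(x,t)=\mathrm{PV}\int_{\mathbb R^2}\frac{\big(\nabla f(x,t)-\nabla f(x-y,t)\big)\cdot y}{\big[|y|^2+(f(x,t)-f(x-y,t))^2\big]^{\frac{3+\alpha}{2}}}\,dy,\qquad f(x,0)=f_0(x),$$ for all $x\in\mathbb R^2$ and $t\in[0,T]$ (with one-sided time derivatives at the endpoints), where $f_0$ and $f(\cdot,t)$ are identified with their continuous representatives. Suppose that $$\|\nabla f_0\|_{L^\infty}<\sqrt{\frac{1+\alpha-\varepsilon}{5+\alpha+\varepsilon}}.$$ Then, for all $t\in[0,T]$, $$\|\nabla f(\cdot,t)\|_{L^\infty}\le\|\nabla f_0\|_{L^\infty}.$$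 -/

import Mathlib

open MeasureTheory Set Filter Topology
open scoped Gradient

noncomputable section

namespace Muskat

/-- The plane `ℝ²` with its Euclidean norm. -/
abbrev Plane : Type := EuclideanSpace ℝ (Fin 2)

/-- The real function `φ` on the plane belongs to the Sobolev space `H^k(ℝ²)`:
it is square integrable, and the tempered distribution that it defines is in `H^k = H^{k,2}`. -/
def MemH (k : ℕ) (φ : Plane → ℝ) : Prop :=
  ∃ u : Lp ℂ 2 (volume : Measure Plane), (u =ᵐ[volume] fun x => (φ x : ℂ)) ∧
    TemperedDistribution.MemSobolev (k : ℝ) 2 (u : TemperedDistribution Plane ℂ)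

/-- `F ∈ L²` is the Bessel potential of order `k` of `φ ∈ L²`, that is,
`F = 𝓕⁻¹ ((1 + |ξ|²)^(k/2) 𝓕 φ)`. So `φ ∈ H^k` exactly when such an `F` exists, and `φ ↦ F` is an
isometry of `H^k` into `L²`, where the norm of `H^k` is `‖(1 + |ξ|²)^(k/2) 𝓕 φ‖_{L²}`. -/
def IsBesselPotential (k : ℕ) (φ : Plane → ℝ) (F : Lp ℂ 2 (volume : Measure Plane)) : Prop :=
  ∃ u : Lp ℂ 2 (volume : Measure Plane), (u =ᵐ[volume] fun x => (φ x : ℂ)) ∧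
    TemperedDistribution.besselPotential Plane ℂ (k : ℝ) (u : TemperedDistribution Plane ℂ)
      = (F : TemperedDistribution Plane ℂ)

/-- `f ∈ C¹([0,T]; H^k(ℝ²))`. Since the Bessel potential of order `k` is an isometry of `H^k`
onto `L²`, this says that `t ↦ (Bessel potential of f(·,t))` is a `C¹` curve in `L²`. -/
def IsC1Curve (k : ℕ) (T : ℝ) (f : ℝ → Plane → ℝ) : Prop :=
  ∃ F : ℝ → Lp ℂ 2 (volume : Measure Plane),
    ContDiffOn ℝ 1 F (Icc 0 T) ∧ ∀ t ∈ Icc 0 T, IsBesselPotential k (f t) (F t)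

/-- The principal value integral `PV ∫_{ℝ²} g(y) dy` exists and equals `v`: the integrals over the
annuli `r < |y| < R` converge to `v` as `r → 0⁺` and `R → ∞`. -/
def HasPV (g : Plane → ℝ) (v : ℝ) : Prop :=
  (∀ r R : ℝ, 0 < r → IntegrableOn g {y | r < ‖y‖ ∧ ‖y‖ < R}) ∧
    Tendsto (fun p : ℝ × ℝ => ∫ y in {y : Plane | p.1 < ‖y‖ ∧ ‖y‖ < p.2}, g y)
      (𝓝[>] 0 ×ˢ atTop) (𝓝 v)

/-- The integrand `y ↦ (∇φ(x) - ∇φ(x-y)) · y / [|y|² + (φ(x) - φ(x-y))²]^((3+α)/2)` of the contour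
equation. -/
def contourIntegrand (α : ℝ) (φ : Plane → ℝ) (x y : Plane) : ℝ :=
  inner ℝ (∇ φ x - ∇ φ (x - y)) y /
    (‖y‖ ^ 2 + (φ x - φ (x - y)) ^ 2) ^ ((3 + α) / 2)

/-- `f` is a solution on `[0,T]`, in the class `C¹([0,T]; H^k(ℝ²))`, of the generalised `α`-Muskat
problem with initial datum `f₀`. As usual `f(·,t) ∈ H^k` stands for its continuous representative.
At `t = 0` and `t = T` the time derivative is one-sided. -/
structure IsSolution (α : ℝ) (k : ℕ) (T : ℝ) (f₀ : Plane → ℝ) (f : ℝ → Plane → ℝ) : Prop where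
  c1_curve : IsC1Curve k T f
  continuous : ∀ t ∈ Icc 0 T, Continuous (f t)
  equation : ∀ t ∈ Icc 0 T, ∀ x : Plane, ∃ v : ℝ,
    HasDerivWithinAt (fun s => f s x) v (Icc 0 T) t ∧ HasPV (contourIntegrand α (f t) x) v
  initial : f 0 = f₀

end Muskat

end

/-!
The gradient bound is equivalent to `f (x + ξ) - f x ≤ L ‖ξ‖` for all `x` and `ξ`, and for fixed `ξ`
this increment obeys a maximum principle. Where it is maximal, the gradients at `x` and `x + ξ`
agree, and the time derivative is the difference of the two principal values. In polar coordinates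
`f x - f (x - ρω) = ρ u(ρ)`, and integrating the radial derivative by parts along a ray replaces the
integrand by a function of the slope `u` alone, which is antitone as long as all slopes are at most
`L` in absolute value and `(5 + α) L² ≤ 1 + α`. Maximality orders the slopes at `x` and `x + ξ`, so
the increment does not grow there, up to a boundary term at radius `r`; this term is
`O(r ^ (β - α))` for a `β`-Hölder gradient and vanishes as `r → 0` when `α < β < 1`. Since the
inequality on `L` is strict for the initial datum and the gradient is uniformly continuous in time,
a continuation argument propagates the bound to `[0, T]`.
-/

namespace Muskat

section FourierTransform

open scoped FourierTransform SchwartzMap ContDiff Real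

theorem norm_fourierChar_sub_le {β : ℝ} (hβ₀ : 0 ≤ β) (hβ₁ : β ≤ 1) (a b : ℝ) :
    ‖(Real.fourierChar a : ℂ) - Real.fourierChar b‖ ≤ 2 * (2 * π * |a - b|) ^ β := by
  have hrotate : ‖(Real.fourierChar a : ℂ) - Real.fourierChar b‖
      = ‖Complex.exp (Complex.I * (2 * π * (a - b) : ℝ)) - 1‖ := by
    rw [show (Real.fourierChar a : ℂ) = Real.fourierChar (a - b) * Real.fourierChar b by
      rw [← Circle.coe_mul, ← AddChar.map_add_eq_mul, sub_add_cancel], ← sub_one_mul, norm_mul,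
      Circle.norm_coe, mul_one, Real.fourierChar_apply, mul_comm Complex.I]
  have habs : |2 * π * (a - b)| = 2 * π * |a - b| := by
    rw [abs_mul, abs_of_pos Real.two_pi_pos]
  rw [hrotate, ← habs]
  set θ := 2 * π * (a - b)
  obtain hθ | hθ := le_total |θ| 1
  · calc ‖Complex.exp (Complex.I * θ) - 1‖ ≤ |θ| := Real.norm_exp_I_mul_ofReal_sub_one_le
      _ ≤ |θ| ^ β := Real.self_le_rpow_of_le_one (abs_nonneg θ) hθ hβ₁
      _ ≤ 2 * |θ| ^ β := le_mul_of_one_le_left (by positivity) one_le_two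
  · calc ‖Complex.exp (Complex.I * θ) - 1‖ ≤ ‖Complex.exp (Complex.I * θ)‖ + ‖(1 : ℂ)‖ :=
          norm_sub_le _ _
      _ = 2 * 1 := by rw [mul_comm, Complex.norm_exp_ofReal_mul_I, norm_one]; norm_num
      _ ≤ 2 * |θ| ^ β := by gcongr; exact Real.one_le_rpow hθ hβ₀

variable {V : Type*} [NormedAddCommGroup V] [InnerProductSpace ℝ V]

theorem norm_reCLM_comp_le (A : V →L[ℝ] ℂ) : ‖Complex.reCLM ∘L A‖ ≤ ‖A‖ := by
  simpa using Complex.reCLM.opNorm_comp_le A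

theorem norm_fourierSMulRight_innerSL (w : V → ℂ) (ξ : V) :
    ‖VectorFourier.fourierSMulRight (innerSL ℝ) w ξ‖ = 2 * π * (‖ξ‖ * ‖w ξ‖) := by
  rw [VectorFourier.norm_fourierSMulRight, innerSL_apply_norm, mul_assoc]

variable [FiniteDimensional ℝ V] [MeasurableSpace V] [BorelSpace V]

section VectorValued

variable {E : Type*} [NormedAddCommGroup E] [NormedSpace ℂ E]

theorem norm_fourier_le_integral (w : V → E) (x : V) : ‖𝓕 w x‖ ≤ ∫ ξ, ‖w ξ‖ :=
  VectorFourier.norm_fourierIntegral_le_integral_norm _ _ (innerₗ V) w x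

theorem norm_fourier_sub_le {w : V → E} {β : ℝ} (hβ₀ : 0 ≤ β) (hβ₁ : β ≤ 1) (hw : Integrable w)
    (hwβ : Integrable fun ξ => ‖ξ‖ ^ β * ‖w ξ‖) (x y : V) :
    ‖𝓕 w x - 𝓕 w y‖ ≤ 2 * (2 * π) ^ β * (∫ ξ, ‖ξ‖ ^ β * ‖w ξ‖) * ‖x - y‖ ^ β := by
  have hint : ∀ z : V, Integrable fun ξ => Real.fourierChar (-inner ℝ ξ z) • w ξ := fun z =>
    (VectorFourier.fourierIntegral_convergent_iff Real.continuous_fourierChar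
      (by exact continuous_inner) z (L := innerₗ V)).2 hw
  rw [Real.fourier_eq, Real.fourier_eq, ← integral_sub (hint x) (hint y), ← integral_const_mul,
    ← integral_mul_const]
  refine norm_integral_le_of_norm_le ((hwβ.const_mul _).mul_const _) (ae_of_all _ fun ξ => ?_)
  have hinner : |-inner ℝ ξ x - -inner ℝ ξ y| ≤ ‖ξ‖ * ‖x - y‖ := by
    rw [neg_sub_neg, ← inner_sub_right, norm_sub_rev]
    exact abs_real_inner_le_norm _ _
  calc ‖Real.fourierChar (-inner ℝ ξ x) • w ξ - Real.fourierChar (-inner ℝ ξ y) • w ξ‖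
      = ‖(Real.fourierChar (-inner ℝ ξ x) : ℂ) - Real.fourierChar (-inner ℝ ξ y)‖ * ‖w ξ‖ := by
        rw [Circle.smul_def, Circle.smul_def, ← sub_smul, norm_smul]
    _ ≤ 2 * (2 * π * (‖ξ‖ * ‖x - y‖)) ^ β * ‖w ξ‖ := by
        gcongr
        refine (norm_fourierChar_sub_le hβ₀ hβ₁ _ _).trans ?_
        gcongr
    _ = 2 * (2 * π) ^ β * (‖ξ‖ ^ β * ‖w ξ‖) * ‖x - y‖ ^ β := by
        rw [Real.mul_rpow (by positivity) (by positivity),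
          Real.mul_rpow (norm_nonneg _) (norm_nonneg _)]
        ring

theorem continuous_fourier {w : V → E} (hw : Integrable w) : Continuous (𝓕 w) :=
  VectorFourier.fourierIntegral_continuous Real.continuous_fourierChar
    (by exact continuous_inner) hw

theorem tendsto_fourier_cocompact (w : V → E) : Tendsto (𝓕 w) (cocompact V) (𝓝 0) :=
  tendsto_integral_exp_inner_smul_cocompact w

end VectorValued

section RealPart

variable {φ : V → ℝ} {w : V → ℂ}

theorem hasFDerivAt_of_eq_fourier (hφ : ∀ x, φ x = 𝓕 w x) (hw : Integrable w)
    (hw₁ : Integrable fun ξ => ‖ξ‖ * ‖w ξ‖) (x : V) :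
    HasFDerivAt φ
      (Complex.reCLM ∘L 𝓕 (VectorFourier.fourierSMulRight (innerSL ℝ) w) x) x :=
  (Complex.reCLM.hasFDerivAt.comp x (Real.hasFDerivAt_fourier hw hw₁ x)).congr_of_eventuallyEq
    (Eventually.of_forall fun y => by simp [← hφ y])

theorem abs_le_integral_of_eq_fourier (hφ : ∀ x, φ x = 𝓕 w x) (x : V) :
    |φ x| ≤ ∫ ξ, ‖w ξ‖ := by
  rw [← Real.norm_eq_abs, ← Complex.norm_real, hφ]
  exact norm_fourier_le_integral w x

theorem norm_gradient_le_of_eq_fourier (hφ : ∀ x, φ x = 𝓕 w x) (hw : Integrable w)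
    (hw₁ : Integrable fun ξ => ‖ξ‖ * ‖w ξ‖) (x : V) :
    ‖∇ φ x‖ ≤ 2 * π * ∫ ξ, ‖ξ‖ * ‖w ξ‖ := by
  rw [gradient, LinearIsometryEquiv.norm_map, (hasFDerivAt_of_eq_fourier hφ hw hw₁ x).fderiv,
    ← integral_const_mul]
  simp_rw [← norm_fourierSMulRight_innerSL]
  exact (norm_reCLM_comp_le _).trans (norm_fourier_le_integral _ x)

theorem norm_gradient_sub_le_of_eq_fourier (hφ : ∀ x, φ x = 𝓕 w x) (hw : Integrable w)
    (hw₁ : Integrable fun ξ => ‖ξ‖ * ‖w ξ‖) {β : ℝ} (hβ₀ : 0 ≤ β) (hβ₁ : β ≤ 1)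
    (hwβ : Integrable fun ξ => ‖ξ‖ ^ (1 + β) * ‖w ξ‖) (x y : V) :
    ‖∇ φ x - ∇ φ y‖ ≤
      2 * (2 * π) ^ β * (2 * π * ∫ ξ, ‖ξ‖ ^ (1 + β) * ‖w ξ‖) * ‖x - y‖ ^ β := by
  set W := VectorFourier.fourierSMulRight (innerSL ℝ) w
  have hnorm : ∀ ξ, ‖ξ‖ ^ β * ‖W ξ‖ = 2 * π * (‖ξ‖ ^ (1 + β) * ‖w ξ‖) := fun ξ => by
    rw [norm_fourierSMulRight_innerSL, Real.rpow_one_add' (norm_nonneg ξ) (by positivity)]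
    ring
  have hWm : AEStronglyMeasurable W := hw.aestronglyMeasurable.fourierSMulRight
  have hW : Integrable W := (hw₁.const_mul (2 * π)).mono' hWm <| ae_of_all _ fun ξ =>
    (norm_fourierSMulRight_innerSL w ξ).le
  have hWβ : Integrable fun ξ => ‖ξ‖ ^ β * ‖W ξ‖ := by
    simpa only [hnorm] using hwβ.const_mul (2 * π)
  have hfourier := norm_fourier_sub_le hβ₀ hβ₁ hW hWβ x y
  simp only [hnorm, integral_const_mul] at hfourier
  rw [gradient, gradient, ← map_sub, LinearIsometryEquiv.norm_map,
    (hasFDerivAt_of_eq_fourier hφ hw hw₁ x).fderiv,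
    (hasFDerivAt_of_eq_fourier hφ hw hw₁ y).fderiv, ← ContinuousLinearMap.comp_sub]
  exact (norm_reCLM_comp_le _).trans hfourier

theorem tendsto_cocompact_of_eq_fourier (hφ : ∀ x, φ x = 𝓕 w x) :
    Tendsto φ (cocompact V) (𝓝 0) := by
  have hlim := (Complex.continuous_re.tendsto 0).comp (tendsto_fourier_cocompact w)
  exact hlim.congr fun x => by simp [← hφ x]

end RealPart

theorem ae_eq_fourierInv_of_fourier_eq (u : Lp ℂ 2 (volume : Measure V)) {v : V → ℂ}
    (hv : Integrable v)
    (huv : ∀ ψ : 𝓢(V, ℂ), 𝓕 (u : TemperedDistribution V ℂ) ψ = ∫ ξ, ψ ξ • v ξ) :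
    u =ᵐ[volume] 𝓕⁻ v := by
  have hcont : Continuous (𝓕⁻ v) := by
    rw [Real.fourierInv_eq_fourier_comp_neg]
    exact continuous_fourier hv.comp_neg
  have hpair : ∀ ψ : 𝓢(V, ℂ), ∫ x, ψ x • u x = ∫ x, ψ x • (𝓕⁻ v) x := by
    intro ψ
    have hadj := VectorFourier.integral_fourierIntegral_smul_eq_flip (L := innerₗ V) (μ := volume)
      (ν := volume) Real.continuous_fourierChar continuous_inner ψ.integrable hv.comp_neg
    rw [flip_innerₗ] at hadj
    calc ∫ x, ψ x • u x = ∫ ξ, (𝓕⁻ ψ) ξ • v ξ := by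
          rw [← huv, TemperedDistribution.fourier_apply, FourierTransform.fourier_fourierInv_eq,
            Lp.toTemperedDistribution_apply]
      _ = ∫ ξ, (𝓕 (ψ : V → ℂ)) ξ • v (-ξ) := by
          rw [SchwartzMap.fourierInv_coe, ← integral_neg_eq_self]
          simp only [Real.fourierInv_eq_fourier_neg, neg_neg]
      _ = _ := by rw [Real.fourierInv_eq_fourier_comp_neg]; exact hadj
  refine ae_eq_of_integral_contDiff_smul_eq ((Lp.memLp u).locallyIntegrable (by norm_num))
    hcont.locallyIntegrable fun g hg hgc => ?_
  have hsupp : HasCompactSupport (Complex.ofRealCLM ∘ g) := hgc.comp_left rfl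
  have hsmooth : ContDiff ℝ ∞ (Complex.ofRealCLM ∘ g) := by fun_prop
  simpa using hpair (hsupp.toSchwartzMap hsmooth)

end FourierTransform

theorem integral_norm_smul_le {X E : Type*} [MeasurableSpace X] {μ : Measure X}
    [NormedAddCommGroup E] [NormedSpace ℝ E] {ρ : X → ℝ} {g : X → E} (hρ : MemLp ρ 2 μ)
    (hg : MemLp g 2 μ) :
    ∫ x, ‖ρ x • g x‖ ∂μ ≤ (eLpNorm ρ 2 μ).toReal * (eLpNorm g 2 μ).toReal := by
  have hnorm : ∫ x, ‖ρ x • g x‖ ∂μ = (eLpNorm (ρ • g) 1 μ).toReal := by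
    rw [eLpNorm_one_eq_lintegral_enorm, ← integral_norm_eq_lintegral_enorm (hρ.1.smul hg.1)]
    rfl
  rw [hnorm, ← ENNReal.toReal_mul]
  exact ENNReal.toReal_mono (ENNReal.mul_ne_top hρ.2.ne hg.2.ne)
    (eLpNorm_smul_le_mul_eLpNorm hg.1 hρ.1)

section JapaneseBracket

variable {V : Type*} [NormedAddCommGroup V]

/-- The power `⟨ξ⟩^s = (1 + |ξ|²)^(s/2)` of the Japanese bracket, the weight that defines `H^s` on
the Fourier side. -/
noncomputable def japaneseBracket (s : ℝ) (ξ : V) : ℝ := (1 + ‖ξ‖ ^ 2) ^ (s / 2)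

theorem japaneseBracket_nonneg (s : ℝ) (ξ : V) : 0 ≤ japaneseBracket s ξ :=
  Real.rpow_nonneg (by positivity) _

theorem japaneseBracket_add (s t : ℝ) (ξ : V) :
    japaneseBracket (s + t) ξ = japaneseBracket s ξ * japaneseBracket t ξ := by
  rw [japaneseBracket, add_div, Real.rpow_add (by positivity)]
  rfl

theorem norm_rpow_le_japaneseBracket {r s : ℝ} (hr : 0 ≤ r) (hrs : r ≤ s) (ξ : V) :
    ‖ξ‖ ^ r ≤ japaneseBracket s ξ :=
  calc ‖ξ‖ ^ r = (‖ξ‖ ^ 2) ^ (r / 2) := by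
        rw [← Real.rpow_natCast_mul (norm_nonneg ξ)]
        push_cast
        rw [mul_div_cancel₀ r two_ne_zero]
    _ ≤ (1 + ‖ξ‖ ^ 2) ^ (r / 2) := by gcongr; simp
    _ ≤ japaneseBracket s ξ :=
        Real.rpow_le_rpow_of_exponent_le (le_add_of_nonneg_right (by positivity)) (by linarith)

@[simp]
theorem japaneseBracket_neg (s : ℝ) (ξ : V) : japaneseBracket s (-ξ) = japaneseBracket s ξ := by
  rw [japaneseBracket, norm_neg, japaneseBracket]

theorem continuous_japaneseBracket (s : ℝ) : Continuous (japaneseBracket s : V → ℝ) :=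
  Continuous.rpow_const (by fun_prop) fun ξ => Or.inl (by positivity)

variable [MeasurableSpace V] [OpensMeasurableSpace V]

theorem integrable_norm_rpow_mul_norm {E : Type*} [NormedAddCommGroup E] {w : V → E}
    {μ : Measure V} {r s : ℝ} (hr : 0 ≤ r) (hrs : r ≤ s) (hwm : AEStronglyMeasurable w μ)
    (hw : Integrable (fun ξ => japaneseBracket s ξ * ‖w ξ‖) μ) :
    Integrable (fun ξ => ‖ξ‖ ^ r * ‖w ξ‖) μ := by
  refine hw.mono' ((continuous_norm.rpow_const fun _ => Or.inr hr).aestronglyMeasurable.mul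
    hwm.norm) (ae_of_all _ fun ξ => ?_)
  rw [Real.norm_of_nonneg (by positivity)]
  gcongr
  exact norm_rpow_le_japaneseBracket hr hrs ξ

theorem integral_norm_rpow_mul_norm_le {E : Type*} [NormedAddCommGroup E] {w : V → E}
    {μ : Measure V} {r s : ℝ} (hr : 0 ≤ r) (hrs : r ≤ s) (hwm : AEStronglyMeasurable w μ)
    (hw : Integrable (fun ξ => japaneseBracket s ξ * ‖w ξ‖) μ) :
    ∫ ξ, ‖ξ‖ ^ r * ‖w ξ‖ ∂μ ≤ ∫ ξ, japaneseBracket s ξ * ‖w ξ‖ ∂μ :=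
  integral_mono (integrable_norm_rpow_mul_norm hr hrs hwm hw) hw fun ξ =>
    mul_le_mul_of_nonneg_right (norm_rpow_le_japaneseBracket hr hrs ξ) (norm_nonneg _)

end JapaneseBracket

section BesselPotential

open scoped FourierTransform SchwartzMap
open TemperedDistribution

variable {V : Type*} [NormedAddCommGroup V] [InnerProductSpace ℝ V] [FiniteDimensional ℝ V]
  [MeasurableSpace V] [BorelSpace V]

theorem memLp_two_japaneseBracket {s : ℝ} (hs : Module.finrank ℝ V < -(2 * s)) :
    MemLp (japaneseBracket s : V → ℝ) 2 := by
  rw [memLp_two_iff_integrable_sq (continuous_japaneseBracket s).aestronglyMeasurable]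
  refine (integrable_rpow_neg_one_add_norm_sq hs).congr (ae_of_all _ fun ξ => ?_)
  simp only [japaneseBracket]
  rw [← Real.rpow_mul_natCast (by positivity)]
  congr 1
  push_cast
  ring

theorem fourier_apply_of_besselPotential_eq {m : ℝ} {u F : Lp ℂ 2 (volume : Measure V)}
    (h : besselPotential V ℂ m (u : TemperedDistribution V ℂ) = (F : TemperedDistribution V ℂ))
    (ψ : 𝓢(V, ℂ)) :
    𝓕 (u : TemperedDistribution V ℂ) ψ = ∫ ξ, ψ ξ • (japaneseBracket (-m) ξ • 𝓕 F ξ) := by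
  have hgrowth : (fun ξ : V => (((1 + ‖ξ‖ ^ 2) ^ (-m / 2) : ℝ) : ℂ)).HasTemperateGrowth := by
    fun_prop
  rw [← (besselPotential_neg_apply_eq_iff _ _ _).2 h,
    fourier_besselPotential_eq_smulLeftCLM_fourier_apply, Lp.fourier_toTemperedDistribution_eq,
    smulLeftCLM_apply_apply, Lp.toTemperedDistribution_apply]
  refine integral_congr_ae (ae_of_all _ fun ξ => ?_)
  simp only [SchwartzMap.smulLeftCLM_apply_apply hgrowth, japaneseBracket, smul_eq_mul,
    Complex.real_smul]
  ring

theorem exists_fourier_of_besselPotential_eq {s m : ℝ} (hs : 0 ≤ s)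
    (hsm : Module.finrank ℝ V < 2 * (m - s)) {u F : Lp ℂ 2 (volume : Measure V)}
    (h : besselPotential V ℂ m (u : TemperedDistribution V ℂ) = (F : TemperedDistribution V ℂ)) :
    ∃ w : V → ℂ, AEStronglyMeasurable w ∧ Integrable (fun ξ => japaneseBracket s ξ * ‖w ξ‖) ∧
      u =ᵐ[volume] 𝓕 w ∧ ∫ ξ, japaneseBracket s ξ * ‖w ξ‖ ≤
        (eLpNorm (japaneseBracket (s - m) : V → ℝ) 2 volume).toReal * ‖F‖ := by
  set v : V → ℂ := fun ξ => japaneseBracket (-m) ξ • 𝓕 F ξ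
  have hvm : AEStronglyMeasurable v :=
    (continuous_japaneseBracket (-m)).aestronglyMeasurable.smul (Lp.memLp (𝓕 F)).1
  have hnorm : ∀ ξ, japaneseBracket s ξ * ‖v ξ‖ = ‖japaneseBracket (s - m) ξ • 𝓕 F ξ‖ :=
    fun ξ => by
      rw [norm_smul, norm_smul, ← mul_assoc, sub_eq_add_neg, japaneseBracket_add, norm_mul,
        Real.norm_of_nonneg (japaneseBracket_nonneg s ξ)]
  have hweight := memLp_two_japaneseBracket (V := V) (s := s - m) (by linarith)
  have hint : Integrable fun ξ => japaneseBracket s ξ * ‖v ξ‖ := by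
    simp only [hnorm]
    exact (memLp_one_iff_integrable.1 ((Lp.memLp (𝓕 F)).smul hweight)).norm
  have hv : Integrable v := by
    simpa [integrable_norm_iff hvm] using integrable_norm_rpow_mul_norm le_rfl hs hvm hint
  have hreflect := integral_neg_eq_self (fun ξ => japaneseBracket s ξ * ‖v ξ‖) volume
  simp only [japaneseBracket_neg] at hreflect
  refine ⟨fun ξ => v (-ξ), hv.comp_neg.1, ?_, ?_, ?_⟩
  · simpa only [japaneseBracket_neg] using hint.comp_neg
  · rw [← Real.fourierInv_eq_fourier_comp_neg]
    exact ae_eq_fourierInv_of_fourier_eq u hv (fourier_apply_of_besselPotential_eq h)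
  · simp only [hreflect, hnorm]
    refine (integral_norm_smul_le hweight (Lp.memLp (𝓕 F))).trans_eq ?_
    rw [← Lp.norm_def, Lp.norm_fourier_eq]

end BesselPotential

theorem holderWith_of_dist_le {X Y : Type*} [PseudoMetricSpace X] [PseudoMetricSpace Y]
    {g : X → Y} {C : ℝ} {β : NNReal} (h : ∀ x y, dist (g x) (g y) ≤ C * dist x y ^ (β : ℝ)) :
    HolderWith C.toNNReal β g := fun x y => by
  rw [edist_dist, edist_dist, ENNReal.ofReal_rpow_of_nonneg dist_nonneg β.coe_nonneg,
    ← ENNReal.ofReal, ← ENNReal.ofReal_mul' (by positivity)]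
  exact ENNReal.ofReal_le_ofReal (h x y)

section Sobolev

open scoped FourierTransform Real

variable {k : ℕ} {φ ψ : Plane → ℝ} {F G : Lp ℂ 2 (volume : Measure Plane)}

theorem IsBesselPotential.sub (hφ : IsBesselPotential k φ F) (hψ : IsBesselPotential k ψ G) :
    IsBesselPotential k (fun x => φ x - ψ x) (F - G) := by
  obtain ⟨u, hu, hF⟩ := hφ
  obtain ⟨v, hv, hG⟩ := hψ
  refine ⟨u - v, ?_, ?_⟩
  · filter_upwards [hu, hv, Lp.coeFn_sub u v] with x hux hvx huvx
    rw [huvx, Pi.sub_apply, hux, hvx, Complex.ofReal_sub]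
  · rw [← Lp.toTemperedDistributionCLM_apply, ← Lp.toTemperedDistributionCLM_apply] at *
    rw [map_sub, map_sub, map_sub, hF, ← hG]

theorem IsBesselPotential.exists_fourier {s : ℝ} (hs : 0 ≤ s) (hsk : s + 1 < k)
    (hφ : IsBesselPotential k φ F) (hφc : Continuous φ) :
    ∃ w : Plane → ℂ, AEStronglyMeasurable w ∧ Integrable (fun ξ => japaneseBracket s ξ * ‖w ξ‖) ∧
      (∀ x, φ x = 𝓕 w x) ∧ ∫ ξ, japaneseBracket s ξ * ‖w ξ‖ ≤
        (eLpNorm (japaneseBracket (s - k) : Plane → ℝ) 2 volume).toReal * ‖F‖ := by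
  obtain ⟨u, hu, hF⟩ := hφ
  obtain ⟨w, hwm, hw, huw, hle⟩ := exists_fourier_of_besselPotential_eq hs
    (by rw [finrank_euclideanSpace_fin]; push_cast; linarith) hF
  have hw₀ : Integrable w := by
    rw [← integrable_norm_iff hwm]
    simpa using integrable_norm_rpow_mul_norm le_rfl hs hwm hw
  have heq : (fun x => (φ x : ℂ)) = 𝓕 w := Measure.eq_of_ae_eq (hu.symm.trans huw)
    (Complex.continuous_ofReal.comp hφc) (continuous_fourier hw₀)
  exact ⟨w, hwm, hw, congrFun heq, hle⟩

theorem IsBesselPotential.tendsto_cocompact (hk : 2 ≤ k) (hφ : IsBesselPotential k φ F)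
    (hφc : Continuous φ) : Tendsto φ (cocompact Plane) (𝓝 0) := by
  have hk' : (2 : ℝ) ≤ k := mod_cast hk
  obtain ⟨w, -, -, heq, -⟩ := hφ.exists_fourier le_rfl (by linarith) hφc
  exact tendsto_cocompact_of_eq_fourier heq

theorem exists_forall_abs_le_mul_norm (hk : 2 ≤ k) :
    ∃ C : ℝ, ∀ {φ : Plane → ℝ} {F}, IsBesselPotential k φ F → Continuous φ →
      ∀ x, |φ x| ≤ C * ‖F‖ := by
  have hk' : (2 : ℝ) ≤ k := mod_cast hk
  refine ⟨(eLpNorm (japaneseBracket (0 - k) : Plane → ℝ) 2 volume).toReal,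
    fun hφ hφc x => ?_⟩
  obtain ⟨w, hwm, hw, heq, hle⟩ := hφ.exists_fourier le_rfl (by linarith) hφc
  have hmono := integral_norm_rpow_mul_norm_le le_rfl le_rfl hwm hw
  simp only [Real.rpow_zero, one_mul] at hmono
  exact (abs_le_integral_of_eq_fourier heq x).trans (hmono.trans hle)

theorem IsBesselPotential.exists_fourier_integrable {β : ℝ} (hβ : 0 ≤ β) (hβk : β + 2 < k)
    (hφ : IsBesselPotential k φ F) (hφc : Continuous φ) :
    ∃ w : Plane → ℂ, (∀ x, φ x = 𝓕 w x) ∧ Integrable w ∧ (Integrable fun ξ => ‖ξ‖ * ‖w ξ‖) ∧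
      (Integrable fun ξ => ‖ξ‖ ^ (1 + β) * ‖w ξ‖) ∧ ∫ ξ, ‖ξ‖ * ‖w ξ‖ ≤
        (eLpNorm (japaneseBracket (1 + β - k) : Plane → ℝ) 2 volume).toReal * ‖F‖ := by
  obtain ⟨w, hwm, hw, heq, hle⟩ :=
    hφ.exists_fourier (s := 1 + β) (by positivity) (by linarith) hφc
  have hmom : ∀ {r : ℝ}, 0 ≤ r → r ≤ 1 + β → Integrable fun ξ => ‖ξ‖ ^ r * ‖w ξ‖ :=
    fun hr hrβ => integrable_norm_rpow_mul_norm hr hrβ hwm hw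
  have hle₁ := integral_norm_rpow_mul_norm_le zero_le_one (by linarith : 1 ≤ 1 + β) hwm hw
  refine ⟨w, heq, (integrable_norm_iff hwm).1 ?_, ?_, hmom (by positivity) le_rfl, ?_⟩
  · simpa using hmom le_rfl (by positivity)
  · simpa using hmom zero_le_one (by linarith)
  · simp only [Real.rpow_one] at hle₁
    exact hle₁.trans hle

theorem exists_forall_norm_gradient_le_mul_norm (hk : 3 ≤ k) :
    ∃ C : ℝ, ∀ {φ : Plane → ℝ} {F}, IsBesselPotential k φ F → Continuous φ →
      ∀ x, ‖∇ φ x‖ ≤ C * ‖F‖ := by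
  have hk' : (3 : ℝ) ≤ k := mod_cast hk
  refine ⟨2 * π * (eLpNorm (japaneseBracket (1 + 0 - k) : Plane → ℝ) 2 volume).toReal,
    fun hφ hφc x => ?_⟩
  obtain ⟨w, heq, hw, hw₁, -, hle⟩ := hφ.exists_fourier_integrable le_rfl (by linarith) hφc
  rw [mul_assoc]
  exact (norm_gradient_le_of_eq_fourier heq hw hw₁ x).trans (by gcongr)

theorem IsBesselPotential.differentiable (hk : 3 ≤ k) (hφ : IsBesselPotential k φ F)
    (hφc : Continuous φ) : Differentiable ℝ φ := by
  have hk' : (3 : ℝ) ≤ k := mod_cast hk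
  obtain ⟨w, heq, hw, hw₁, -⟩ := hφ.exists_fourier_integrable le_rfl (by linarith) hφc
  exact fun x => (hasFDerivAt_of_eq_fourier heq hw hw₁ x).differentiableAt

theorem IsBesselPotential.exists_holderWith_gradient (hk : 3 ≤ k) {β : NNReal} (hβ : β < 1)
    (hφ : IsBesselPotential k φ F) (hφc : Continuous φ) : ∃ K, HolderWith K β (∇ φ) := by
  have hk' : (3 : ℝ) ≤ k := mod_cast hk
  have hβ' : (β : ℝ) < 1 := mod_cast hβ
  obtain ⟨w, heq, hw, hw₁, hwβ, -⟩ :=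
    hφ.exists_fourier_integrable β.coe_nonneg (by linarith) hφc
  exact ⟨_, holderWith_of_dist_le fun x y => by
    simpa only [dist_eq_norm] using
      norm_gradient_sub_le_of_eq_fourier heq hw hw₁ β.coe_nonneg hβ'.le hwβ x y⟩

end Sobolev

section Gradient

variable {V : Type*} [NormedAddCommGroup V] [InnerProductSpace ℝ V] [CompleteSpace V]
  {φ ψ : V → ℝ}

theorem hasFDerivAt_toDual_gradient (hφ : Differentiable ℝ φ) (x : V) :
    HasFDerivAt φ (InnerProductSpace.toDual ℝ V (∇ φ x)) x :=
  (hφ x).hasGradientAt.hasFDerivAt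

theorem gradient_fun_sub {x : V} (hφ : DifferentiableAt ℝ φ x) (hψ : DifferentiableAt ℝ ψ x) :
    ∇ (fun y => φ y - ψ y) x = ∇ φ x - ∇ ψ x := by
  rw [gradient, gradient, gradient, fderiv_fun_sub hφ hψ, map_sub]

theorem abs_sub_le_of_norm_gradient_le {L : ℝ} (hφ : Differentiable ℝ φ)
    (hL : ∀ x, ‖∇ φ x‖ ≤ L) (x y : V) : |φ x - φ y| ≤ L * ‖x - y‖ :=
  convex_univ.norm_image_sub_le_of_norm_hasFDerivWithin_le (𝕜 := ℝ)
    (fun w _ => (hasFDerivAt_toDual_gradient hφ w).hasFDerivWithinAt)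
    (fun w _ => (LinearIsometryEquiv.norm_map _ _).trans_le (hL w)) (mem_univ y) (mem_univ x)

theorem abs_sub_sub_inner_gradient_le {K β : NNReal} (hφ : Differentiable ℝ φ)
    (hK : HolderWith K β (∇ φ)) (x y : V) :
    |φ x - φ (x - y) - inner ℝ (∇ φ x) y| ≤ K * ‖y‖ ^ (β : ℝ) * ‖y‖ := by
  have hball : ∀ w ∈ Metric.closedBall x ‖y‖,
      ‖InnerProductSpace.toDual ℝ V (∇ φ w) - InnerProductSpace.toDual ℝ V (∇ φ x)‖ ≤
        K * ‖y‖ ^ (β : ℝ) := fun w hw => by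
    rw [← map_sub, LinearIsometryEquiv.norm_map, ← dist_eq_norm]
    exact hK.dist_le_of_le hw
  have htaylor := (convex_closedBall x ‖y‖).norm_image_sub_le_of_norm_hasFDerivWithin_le' (𝕜 := ℝ)
    (fun w _ => (hasFDerivAt_toDual_gradient hφ w).hasFDerivWithinAt) hball
    (x := x - y) (y := x) (by simp) (by simp)
  simpa using htaylor

theorem gradient_eq_of_isMax_increment (hφ : Differentiable ℝ φ) {ξ x : V}
    (hmax : ∀ y, φ (y + ξ) - φ y ≤ φ (x + ξ) - φ x) : ∇ φ (x + ξ) = ∇ φ x := by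
  have hlocal : IsLocalMax (fun y => φ (y + ξ) - φ y) x := Eventually.of_forall hmax
  have hderiv := ((hasFDerivAt_comp_add_right ξ).2 (hφ (x + ξ)).hasFDerivAt).sub
    (hφ x).hasFDerivAt
  rw [gradient, gradient, sub_eq_zero.1 (hlocal.hasFDerivAt_eq_zero hderiv)]

theorem norm_gradient_le_of_increment_le {L : ℝ} (hL : 0 ≤ L)
    (h : ∀ ξ x, φ (x + ξ) - φ x ≤ L * ‖ξ‖) (x : V) : ‖∇ φ x‖ ≤ L := by
  have hlip : LipschitzWith ⟨L, hL⟩ φ := LipschitzWith.of_le_add_mul _ fun y z => by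
    have hyz := h (y - z) z
    rw [add_sub_cancel, ← dist_eq_norm] at hyz
    exact sub_le_iff_le_add'.1 hyz
  rw [gradient, LinearIsometryEquiv.norm_map]
  exact norm_fderiv_le_of_lipschitz ℝ hlip

theorem hasDerivAt_sub_comp_sub_smul (hφ : Differentiable ℝ φ) (x ω : V) (ρ : ℝ) :
    HasDerivAt (fun s : ℝ => φ x - φ (x - s • ω)) (inner ℝ (∇ φ (x - ρ • ω)) ω) ρ := by
  have hray : HasDerivAt (fun s : ℝ => x - s • ω) (-ω) ρ := by
    simpa using ((hasDerivAt_id ρ).smul_const ω).const_sub x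
  simpa using ((hasFDerivAt_toDual_gradient hφ (x - ρ • ω)).comp_hasDerivAt ρ hray).const_sub (φ x)

end Gradient

section Solution

variable {k : ℕ} {α T t : ℝ} {f₀ : Plane → ℝ} {f : ℝ → Plane → ℝ}

theorem IsSolution.exists_isBesselPotential (hf : IsSolution α k T f₀ f) (ht : t ∈ Icc 0 T) :
    ∃ F, IsBesselPotential k (f t) F :=
  let ⟨F, _, hfF⟩ := hf.c1_curve
  ⟨F t, hfF t ht⟩

theorem IsC1Curve.exists_tendsto_isBesselPotential_sub (hf : IsC1Curve k T f) (ht : t ∈ Icc 0 T) :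
    ∃ G : ℝ → Lp ℂ 2 (volume : Measure Plane), Tendsto (fun s => ‖G s‖) (𝓝[Icc 0 T] t) (𝓝 0) ∧
      ∀ s ∈ Icc 0 T, IsBesselPotential k (fun x => f t x - f s x) (G s) := by
  obtain ⟨F, hF, hfF⟩ := hf
  refine ⟨fun s => F t - F s, ?_, fun s hs => (hfF t ht).sub (hfF s hs)⟩
  simpa using ((tendsto_const_nhds (x := F t)).sub (hF.continuousOn t ht)).norm

theorem tendstoUniformly_of_norm_sub_le {X E : Type*} [NormedAddCommGroup E] {l : Filter ℝ}
    {g : ℝ → X → E} {g₀ : X → E} {b : ℝ → ℝ} (hb : Tendsto b l (𝓝 0))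
    (h : ∀ᶠ s in l, ∀ x, ‖g₀ x - g s x‖ ≤ b s) : TendstoUniformly g g₀ l := by
  rw [Metric.tendstoUniformly_iff]
  intro ε hε
  filter_upwards [h, hb.eventually_lt_const hε] with s hs hbs x
  rw [dist_eq_norm]
  exact (hs x).trans_lt hbs

theorem IsSolution.tendstoUniformly (hf : IsSolution α k T f₀ f) (hk : 2 ≤ k)
    (ht : t ∈ Icc 0 T) : TendstoUniformly f (f t) (𝓝[Icc 0 T] t) := by
  obtain ⟨C, hC⟩ := exists_forall_abs_le_mul_norm hk
  obtain ⟨G, hG, hfG⟩ := hf.c1_curve.exists_tendsto_isBesselPotential_sub ht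
  refine tendstoUniformly_of_norm_sub_le (by simpa using hG.const_mul C) ?_
  filter_upwards [self_mem_nhdsWithin] with s hs
  exact hC (hfG s hs) ((hf.continuous t ht).sub (hf.continuous s hs))

theorem IsSolution.differentiable (hf : IsSolution α k T f₀ f) (hk : 3 ≤ k) (ht : t ∈ Icc 0 T) :
    Differentiable ℝ (f t) := by
  obtain ⟨F, hF⟩ := hf.exists_isBesselPotential ht
  exact hF.differentiable hk (hf.continuous t ht)

theorem IsSolution.tendsto_cocompact (hf : IsSolution α k T f₀ f) (hk : 2 ≤ k)
    (ht : t ∈ Icc 0 T) : Tendsto (f t) (cocompact Plane) (𝓝 0) := by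
  obtain ⟨F, hF⟩ := hf.exists_isBesselPotential ht
  exact hF.tendsto_cocompact hk (hf.continuous t ht)

theorem IsSolution.exists_holderWith_gradient (hf : IsSolution α k T f₀ f) (hk : 3 ≤ k)
    (ht : t ∈ Icc 0 T) {β : NNReal} (hβ : β < 1) : ∃ K, HolderWith K β (∇ (f t)) := by
  obtain ⟨F, hF⟩ := hf.exists_isBesselPotential ht
  exact hF.exists_holderWith_gradient hk hβ (hf.continuous t ht)

theorem IsSolution.continuous_gradient (hf : IsSolution α k T f₀ f) (hk : 3 ≤ k)
    (ht : t ∈ Icc 0 T) : Continuous (∇ (f t)) := by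
  obtain ⟨K, hK⟩ := hf.exists_holderWith_gradient hk ht (β := 1 / 2) (by norm_num)
  exact hK.continuous (by norm_num)

theorem IsSolution.tendstoUniformly_gradient (hf : IsSolution α k T f₀ f) (hk : 3 ≤ k)
    (ht : t ∈ Icc 0 T) :
    TendstoUniformly (fun s => ∇ (f s)) (∇ (f t)) (𝓝[Icc 0 T] t) := by
  obtain ⟨C, hC⟩ := exists_forall_norm_gradient_le_mul_norm hk
  obtain ⟨G, hG, hfG⟩ := hf.c1_curve.exists_tendsto_isBesselPotential_sub ht
  refine tendstoUniformly_of_norm_sub_le (by simpa using hG.const_mul C) ?_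
  filter_upwards [self_mem_nhdsWithin] with s hs x
  rw [← gradient_fun_sub (hf.differentiable hk ht x) (hf.differentiable hk hs x)]
  exact hC (hfG s hs) ((hf.continuous t ht).sub (hf.continuous s hs)) x

end Solution

section RadialKernel

/-- The primitive `∫₀ᵘ (1 + s²)^(-p) ds`, an odd increasing function of the slope `u`. -/
noncomputable def slopePrimitive (p u : ℝ) : ℝ := ∫ s in (0 : ℝ)..u, (1 + s ^ 2) ^ (-p)

theorem hasDerivAt_slopePrimitive (p u : ℝ) :
    HasDerivAt (slopePrimitive p) ((1 + u ^ 2) ^ (-p)) u := by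
  have hcont : Continuous fun s : ℝ => (1 + s ^ 2) ^ (-p) :=
    Continuous.rpow_const (by fun_prop) fun s => Or.inl (by positivity)
  exact (hcont.integral_hasStrictDerivAt 0 u).hasDerivAt

theorem monotone_slopePrimitive (p : ℝ) : Monotone (slopePrimitive p) :=
  monotone_of_hasDerivAt_nonneg (hasDerivAt_slopePrimitive p) fun u =>
    Real.rpow_nonneg (by positivity) _

theorem slopePrimitive_sub_le {p u v : ℝ} (hp : 0 ≤ p) (huv : u ≤ v) :
    slopePrimitive p v - slopePrimitive p u ≤ v - u := by
  have hmono : Monotone fun s => s - slopePrimitive p s :=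
    monotone_of_hasDerivAt_nonneg
      (fun s => (hasDerivAt_id s).sub (hasDerivAt_slopePrimitive p s)) fun s =>
        sub_nonneg.2 (Real.rpow_le_one_of_one_le_of_nonpos (by simp [sq_nonneg]) (by linarith))
  linarith [hmono huv]

/-- The kernel of the contour equation in polar form, after the radial derivative has been
integrated by parts: `a` is the radial slope at the base point and `u` that of the chord. -/
noncomputable def slopeKernel (α a u : ℝ) : ℝ :=
  (a - u) * (1 + u ^ 2) ^ (-((3 + α) / 2)) - α * slopePrimitive ((3 + α) / 2) u

theorem hasDerivAt_slopeKernel (α a u : ℝ) :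
    HasDerivAt (slopeKernel α a)
      (-((1 + u ^ 2) ^ (-((3 + α) / 2) - 1) * (1 + α - 2 * u ^ 2 + (3 + α) * (u * a)))) u := by
  have hsq : HasDerivAt (fun s : ℝ => 1 + s ^ 2) (2 * u) u := by
    simpa using (hasDerivAt_pow 2 u).const_add 1
  have hrpow := hsq.rpow_const (p := -((3 + α) / 2)) (Or.inl (by positivity))
  refine ((((hasDerivAt_id u).const_sub a).mul hrpow).sub
    ((hasDerivAt_slopePrimitive _ u).const_mul α)).congr_deriv ?_
  have hsplit : (1 + u ^ 2) ^ (-((3 + α) / 2)) =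
      (1 + u ^ 2) ^ (-((3 + α) / 2) - 1) * (1 + u ^ 2) := by
    rw [← Real.rpow_add_one (by positivity), sub_add_cancel]
  rw [hsplit]
  simp only [id_eq]
  ring

variable {α a L : ℝ}

theorem slope_quadratic_nonneg (hα : -3 ≤ α) (hL : (5 + α) * L ^ 2 ≤ 1 + α) (ha : |a| ≤ L)
    {u : ℝ} (hu : |u| ≤ L) : 0 ≤ 1 + α - 2 * u ^ 2 + (3 + α) * (u * a) := by
  have hua : -(L * L) ≤ u * a := by
    rw [← neg_le_neg_iff, neg_neg, ← neg_mul]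
    calc -u * a ≤ |-u * a| := le_abs_self _
      _ = |u| * |a| := by rw [abs_mul, abs_neg]
      _ ≤ L * L := mul_le_mul hu ha (abs_nonneg a) ((abs_nonneg u).trans hu)
  have husq : u ^ 2 ≤ L ^ 2 := sq_le_sq' (abs_le.1 hu).1 (abs_le.1 hu).2
  have hmul := mul_le_mul_of_nonneg_left hua (show 0 ≤ 3 + α by linarith)
  linarith

theorem antitoneOn_slopeKernel (hα : -3 ≤ α) (hL : (5 + α) * L ^ 2 ≤ 1 + α) (ha : |a| ≤ L) :
    AntitoneOn (slopeKernel α a) (Icc (-L) L) := by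
  refine antitoneOn_of_hasDerivWithinAt_nonpos (convex_Icc _ _)
    (fun u _ => (hasDerivAt_slopeKernel α a u).continuousAt.continuousWithinAt)
    (fun u _ => (hasDerivAt_slopeKernel α a u).hasDerivWithinAt) fun u hu => ?_
  exact neg_nonpos.2 (mul_nonneg (by positivity)
    (slope_quadratic_nonneg hα hL ha (abs_le.2 (mem_Icc.1 (interior_subset hu)))))

theorem slopeKernel_div_le (hα : -3 ≤ α) (hL : (5 + α) * L ^ 2 ≤ 1 + α) (ha : |a| ≤ L)
    {u v ρ : ℝ} (hρ : 0 < ρ) (hu : |u| ≤ L * ρ) (hv : |v| ≤ L * ρ) (hvu : v ≤ u) :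
    slopeKernel α a (u / ρ) ≤ slopeKernel α a (v / ρ) := by
  have hslope : ∀ {s : ℝ}, |s| ≤ L * ρ → s / ρ ∈ Icc (-L) L := fun hs => by
    rwa [mem_Icc, ← abs_le, abs_div, abs_of_pos hρ, div_le_iff₀ hρ]
  exact antitoneOn_slopeKernel hα hL ha (hslope hv) (hslope hu) (by gcongr)

/-- The integrand of the contour equation along the ray of direction `ω`, times the polar weight
`ρ`: here `a = ∇φ(x)·ω`, while `u = φ(x) - φ(x - ρω)` and `u'` is its radial derivative. -/
noncomputable def rayIntegrand (α a u u' ρ : ℝ) : ℝ :=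
  ρ ^ 2 * (a - u') / (ρ ^ 2 + u ^ 2) ^ ((3 + α) / 2)

theorem rayIntegrand_eq_rpow_mul {ρ : ℝ} (hρ : 0 < ρ) (α a u u' : ℝ) :
    rayIntegrand α a u u' ρ =
      ρ ^ (-1 - α) * ((a - u') * (1 + (u / ρ) ^ 2) ^ (-((3 + α) / 2))) := by
  have hfactor : ρ ^ 2 + u ^ 2 = ρ ^ 2 * (1 + (u / ρ) ^ 2) := by field_simp
  have hpow : (ρ ^ 2) ^ ((3 + α) / 2) = ρ ^ (3 + α) := by
    rw [← Real.rpow_natCast_mul hρ.le]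
    push_cast
    rw [mul_div_cancel₀ _ two_ne_zero]
  have hsq : ρ ^ 2 = ρ ^ (-1 - α) * ρ ^ (3 + α) := by
    rw [← Real.rpow_add hρ, ← Real.rpow_natCast]
    congr 1
    push_cast
    ring
  rw [rayIntegrand, hfactor, Real.mul_rpow (by positivity) (by positivity), hpow,
    Real.rpow_neg (by positivity), hsq]
  field_simp

theorem hasDerivAt_rpow_mul_slopePrimitive {ρ g' : ℝ} {g : ℝ → ℝ} (hρ : 0 < ρ)
    (hg : HasDerivAt g g' ρ) (α a : ℝ) :
    HasDerivAt (fun s => s ^ (-α) * slopePrimitive ((3 + α) / 2) (g s / s))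
      (ρ ^ (-1 - α) * slopeKernel α a (g ρ / ρ) - rayIntegrand α a (g ρ) g' ρ) ρ := by
  have hrpow : HasDerivAt (fun s : ℝ => s ^ (-α)) (-α * ρ ^ (-α - 1)) ρ :=
    Real.hasDerivAt_rpow_const (Or.inl hρ.ne')
  have hslope : HasDerivAt (fun s => g s / s) ((g' * ρ - g ρ) / ρ ^ 2) ρ := by
    simpa using hg.fun_div (hasDerivAt_id ρ) hρ.ne'
  have hprim := HasDerivAt.comp ρ (hasDerivAt_slopePrimitive ((3 + α) / 2) _) hslope
  refine (hrpow.mul hprim).congr_deriv ?_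
  have hsplit : ρ ^ (-α) = ρ ^ (-1 - α) * ρ := by
    rw [← Real.rpow_add_one hρ.ne', sub_add_eq_add_sub, neg_add_cancel, zero_sub]
  rw [rayIntegrand_eq_rpow_mul hρ, hsplit, ← neg_add', add_comm α 1, neg_add', slopeKernel]
  simp only [Function.comp_apply]
  field_simp
  ring

theorem continuousOn_rayIntegrand {s : Set ℝ} (hs : ∀ ρ ∈ s, 0 < ρ) {g g' : ℝ → ℝ}
    (hg : ContinuousOn g s) (hg' : ContinuousOn g' s) (α a : ℝ) :
    ContinuousOn (fun ρ => rayIntegrand α a (g ρ) (g' ρ) ρ) s := by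
  have hpos : ∀ ρ ∈ s, 0 < ρ ^ 2 + g ρ ^ 2 := fun ρ hρ => by
    have := hs ρ hρ
    positivity
  exact ContinuousOn.div (by fun_prop)
    (ContinuousOn.rpow_const (by fun_prop) fun ρ hρ => Or.inl (hpos ρ hρ).ne')
    fun ρ hρ => (Real.rpow_pos_of_pos (hpos ρ hρ) _).ne'

theorem integral_rayIntegrand_sub_le (hα : -3 ≤ α) (hL : (5 + α) * L ^ 2 ≤ 1 + α)
    (ha : |a| ≤ L) {r R : ℝ} (hr : 0 < r) (hrR : r ≤ R) {g h g' h' : ℝ → ℝ}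
    (hg : ∀ ρ ∈ Icc r R, HasDerivAt g (g' ρ) ρ) (hh : ∀ ρ ∈ Icc r R, HasDerivAt h (h' ρ) ρ)
    (hg' : ContinuousOn g' (Icc r R)) (hh' : ContinuousOn h' (Icc r R))
    (hgL : ∀ ρ ∈ Icc r R, |g ρ| ≤ L * ρ) (hhL : ∀ ρ ∈ Icc r R, |h ρ| ≤ L * ρ)
    (hle : ∀ ρ ∈ Icc r R, h ρ ≤ g ρ) :
    ∫ ρ in r..R, (rayIntegrand α a (g ρ) (g' ρ) ρ - rayIntegrand α a (h ρ) (h' ρ) ρ) ≤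
      r ^ (-α) * ((g r - h r) / r) := by
  have hpos : ∀ ρ ∈ Icc r R, 0 < ρ := fun ρ hρ => hr.trans_le hρ.1
  have hderiv : ∀ ρ ∈ Icc r R, HasDerivAt _ _ ρ := fun ρ hρ =>
    (hasDerivAt_rpow_mul_slopePrimitive (hpos ρ hρ) (hh ρ hρ) α a).fun_sub
      (hasDerivAt_rpow_mul_slopePrimitive (hpos ρ hρ) (hg ρ hρ) α a)
  have hcont : ContinuousOn (fun ρ => rayIntegrand α a (g ρ) (g' ρ) ρ -
      rayIntegrand α a (h ρ) (h' ρ) ρ) (Icc r R) :=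
    (continuousOn_rayIntegrand hpos (HasDerivAt.continuousOn hg) hg' α a).sub
      (continuousOn_rayIntegrand hpos (HasDerivAt.continuousOn hh) hh' α a)
  have hftc := intervalIntegral.integral_le_sub_of_hasDeriv_right_of_le hrR
    (fun ρ hρ => (hderiv ρ hρ).continuousAt.continuousWithinAt)
    (fun ρ hρ => (hderiv ρ (Ioo_subset_Icc_self hρ)).hasDerivWithinAt) hcont.integrableOn_Icc
    fun ρ hρ => by
      have hρI := Ioo_subset_Icc_self hρ
      have hkernel := mul_le_mul_of_nonneg_left
        (slopeKernel_div_le hα hL ha (hpos ρ hρI) (hgL ρ hρI) (hhL ρ hρI) (hle ρ hρI))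
        (Real.rpow_nonneg (hpos ρ hρI).le (-1 - α))
      linarith
  have houter : R ^ (-α) * slopePrimitive ((3 + α) / 2) (h R / R) ≤
      R ^ (-α) * slopePrimitive ((3 + α) / 2) (g R / R) := by
    have := hr.trans_le hrR
    gcongr
    exact monotone_slopePrimitive _ (by gcongr; exact hle R (right_mem_Icc.2 hrR))
  have hinner : r ^ (-α) * (slopePrimitive ((3 + α) / 2) (g r / r) -
      slopePrimitive ((3 + α) / 2) (h r / r)) ≤ r ^ (-α) * ((g r - h r) / r) := by
    rw [sub_div]
    exact mul_le_mul_of_nonneg_left (slopePrimitive_sub_le (by linarith)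
      (div_le_div_of_nonneg_right (hle r (left_mem_Icc.2 hrR)) hr.le)) (by positivity)
  linarith

end RadialKernel

section Polar

theorem integral_volumeIoiPow {F : Type*} [NormedAddCommGroup F] [NormedSpace ℝ F] (n : ℕ)
    (g : ℝ → F) :
    ∫ ρ : Ioi (0 : ℝ), g ρ ∂Measure.volumeIoiPow n = ∫ ρ in Ioi (0 : ℝ), ρ ^ n • g ρ := by
  simp only [Measure.volumeIoiPow, ENNReal.ofReal]
  rw [integral_withDensity_eq_integral_smul (measurable_subtype_coe.pow_const _).real_toNNReal,
    integral_subtype_comap measurableSet_Ioi fun ρ : ℝ => Real.toNNReal (ρ ^ n) • g ρ]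
  refine setIntegral_congr_fun measurableSet_Ioi fun ρ hρ => ?_
  simp only [NNReal.smul_def, Real.coe_toNNReal _ (pow_nonneg (le_of_lt hρ) n)]

theorem homeomorphUnitSphereProd_smul {E : Type*} [NormedAddCommGroup E] [NormedSpace ℝ E]
    (y : ({0}ᶜ : Set E)) :
    ((homeomorphUnitSphereProd E y).2 : ℝ) • ((homeomorphUnitSphereProd E y).1 : E) = y := by
  simp [smul_smul, norm_ne_zero_iff.2 y.2]

theorem setIntegral_Ioi_indicator_annulus {E F : Type*} [NormedAddCommGroup E] [NormedSpace ℝ E]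
    [NormedAddCommGroup F] [NormedSpace ℝ F] {r R : ℝ} (hr : 0 ≤ r) (hrR : r ≤ R) (n : ℕ)
    (d : E → F) {ω : E} (hω : ‖ω‖ = 1) :
    ∫ ρ in Ioi (0 : ℝ), ρ ^ n • {y : E | r < ‖y‖ ∧ ‖y‖ < R}.indicator d (ρ • ω) =
      ∫ ρ in r..R, ρ ^ n • d (ρ • ω) := by
  have hmem : ∀ ρ ∈ Ioi (0 : ℝ), ρ ∈ Ioo r R ↔ ρ • ω ∈ {y : E | r < ‖y‖ ∧ ‖y‖ < R} := by
    intro ρ hρ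
    rw [mem_ofPred_eq, norm_smul, hω, mul_one, Real.norm_of_nonneg (le_of_lt hρ), mem_Ioo]
  calc ∫ ρ in Ioi (0 : ℝ), ρ ^ n • {y : E | r < ‖y‖ ∧ ‖y‖ < R}.indicator d (ρ • ω)
      = ∫ ρ in Ioi (0 : ℝ), (Ioo r R).indicator (fun ρ => ρ ^ n • d (ρ • ω)) ρ := by
        refine setIntegral_congr_fun measurableSet_Ioi fun ρ hρ => ?_
        by_cases h : ρ ∈ Ioo r R
        · simp only [indicator_of_mem h, indicator_of_mem ((hmem ρ hρ).1 h)]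
        · simp only [indicator_of_notMem h, indicator_of_notMem (mt (hmem ρ hρ).2 h), smul_zero]
    _ = ∫ ρ in r..R, ρ ^ n • d (ρ • ω) := by
        rw [setIntegral_indicator measurableSet_Ioo,
          inter_eq_right.2 (Ioo_subset_Ioi_self.trans (Ioi_subset_Ioi hr)),
          intervalIntegral.integral_of_le hrR, integral_Ioc_eq_integral_Ioo]

variable {E F : Type*} [NormedAddCommGroup E] [NormedSpace ℝ E] [FiniteDimensional ℝ E]
  [MeasurableSpace E] [BorelSpace E] {μ : Measure E} [μ.IsAddHaarMeasure]
  [NormedAddCommGroup F] {e : E → F}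

theorem integrable_comp_polar (he : Integrable e μ) :
    Integrable (fun z : Metric.sphere (0 : E) 1 × Ioi (0 : ℝ) => e ((z.2 : ℝ) • (z.1 : E)))
      (μ.toSphere.prod (.volumeIoiPow (Module.finrank ℝ E - 1))) := by
  rw [← μ.measurePreserving_homeomorphUnitSphereProd.integrable_comp_emb
    (homeomorphUnitSphereProd E).measurableEmbedding]
  simp only [Function.comp_def, homeomorphUnitSphereProd_smul]
  exact (integrableOn_iff_comap_subtypeVal (measurableSet_singleton _).compl).1 he.integrableOn

theorem integral_eq_integral_sphere [Nontrivial E] [NormedSpace ℝ F]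
    (he : Integrable e μ) :
    ∫ y, e y ∂μ = ∫ ω : Metric.sphere (0 : E) 1,
      (∫ ρ in Ioi (0 : ℝ), ρ ^ (Module.finrank ℝ E - 1) • e (ρ • (ω : E))) ∂μ.toSphere := by
  calc ∫ y, e y ∂μ = ∫ y : ({0}ᶜ : Set E), e y ∂μ.comap (↑) := by
        rw [integral_subtype_comap (measurableSet_singleton _).compl, restrict_compl_singleton]
    _ = ∫ z : Metric.sphere (0 : E) 1 × Ioi (0 : ℝ), e ((z.2 : ℝ) • (z.1 : E))
          ∂μ.toSphere.prod (.volumeIoiPow (Module.finrank ℝ E - 1)) := by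
        rw [← μ.measurePreserving_homeomorphUnitSphereProd.integral_comp
          (homeomorphUnitSphereProd E).measurableEmbedding]
        simp only [homeomorphUnitSphereProd_smul]
    _ = ∫ ω : Metric.sphere (0 : E) 1, (∫ ρ : Ioi (0 : ℝ), e ((ρ : ℝ) • (ω : E))
          ∂.volumeIoiPow (Module.finrank ℝ E - 1)) ∂μ.toSphere :=
        integral_prod _ (integrable_comp_polar he)
    _ = ∫ ω : Metric.sphere (0 : E) 1,
          (∫ ρ in Ioi (0 : ℝ), ρ ^ (Module.finrank ℝ E - 1) • e (ρ • (ω : E))) ∂μ.toSphere :=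
        integral_congr_ae (ae_of_all _ fun ω =>
          integral_volumeIoiPow _ fun ρ => e (ρ • (ω : E)))

theorem setIntegral_annulus_le [Nontrivial E] {d : E → ℝ} {r R B : ℝ} (hr : 0 ≤ r) (hrR : r ≤ R)
    (hd : IntegrableOn d {y | r < ‖y‖ ∧ ‖y‖ < R} μ)
    (hB : ∀ ω : E, ‖ω‖ = 1 → ∫ ρ in r..R, ρ ^ (Module.finrank ℝ E - 1) * d (ρ • ω) ≤ B) :
    ∫ y in {y : E | r < ‖y‖ ∧ ‖y‖ < R}, d y ∂μ ≤ B * μ.toSphere.real univ := by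
  have hmeas : MeasurableSet {y : E | r < ‖y‖ ∧ ‖y‖ < R} :=
    ((isOpen_lt continuous_const continuous_norm).inter
      (isOpen_lt continuous_norm continuous_const)).measurableSet
  have hint := hd.integrable_indicator hmeas
  have hinner := (integrable_comp_polar hint).integral_prod_left.congr <| ae_of_all _ fun ω =>
    integral_volumeIoiPow _ fun ρ => indicator {y | r < ‖y‖ ∧ ‖y‖ < R} d (ρ • (ω : E))
  rw [← integral_indicator hmeas, integral_eq_integral_sphere hint]
  refine (integral_mono hinner (integrable_const B) fun ω => ?_).trans_eq ?_
  · have hω : ‖(ω : E)‖ = 1 := by simp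
    exact (setIntegral_Ioi_indicator_annulus hr hrR _ d hω).trans_le (hB ω hω)
  · rw [integral_const, smul_eq_mul, mul_comm]

end Polar

section Comparison

variable {α L : ℝ} {K β : NNReal} {φ : Plane → ℝ} {x z : Plane}

theorem mul_contourIntegrand_smul (α : ℝ) (φ : Plane → ℝ) (x : Plane) {ω : Plane} (hω : ‖ω‖ = 1)
    (ρ : ℝ) :
    ρ * contourIntegrand α φ x (ρ • ω) =
      rayIntegrand α (inner ℝ (∇ φ x) ω) (φ x - φ (x - ρ • ω)) (inner ℝ (∇ φ (x - ρ • ω)) ω) ρ := by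
  have hnorm : ‖ρ • ω‖ ^ 2 = ρ ^ 2 := by
    rw [norm_smul, hω, mul_one, Real.norm_eq_abs, sq_abs]
  simp only [contourIntegrand, rayIntegrand, inner_smul_right, inner_sub_left, hnorm]
  ring

theorem increment_sub_increment_le (hφ : Differentiable ℝ φ) (hK : HolderWith K β (∇ φ))
    (heq : ∇ φ z = ∇ φ x) (y : Plane) :
    (φ z - φ (z - y)) - (φ x - φ (x - y)) ≤ 2 * K * ‖y‖ ^ (β : ℝ) * ‖y‖ := by
  have hz := (abs_le.1 (abs_sub_sub_inner_gradient_le hφ hK z y)).2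
  have hx := (abs_le.1 (abs_sub_sub_inner_gradient_le hφ hK x y)).1
  rw [heq] at hz
  linarith

theorem integral_ray_contourIntegrand_sub_le (hα : -3 ≤ α) (hL : (5 + α) * L ^ 2 ≤ 1 + α)
    (hφ : Differentiable ℝ φ) (hβ : 0 < β) (hK : HolderWith K β (∇ φ)) (hgrad : ∀ y, ‖∇ φ y‖ ≤ L)
    (heq : ∇ φ z = ∇ φ x) (hmax : ∀ y, φ (z - y) - φ (x - y) ≤ φ z - φ x)
    {r R : ℝ} (hr : 0 < r) (hrR : r ≤ R) {ω : Plane} (hω : ‖ω‖ = 1) :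
    ∫ ρ in r..R, ρ * (contourIntegrand α φ z (ρ • ω) - contourIntegrand α φ x (ρ • ω)) ≤
      2 * K * r ^ (β - α) := by
  have hnorm : ∀ ρ, 0 < ρ → ‖ρ • ω‖ = ρ := fun ρ hρ => by
    rw [norm_smul, hω, mul_one, Real.norm_of_nonneg hρ.le]
  have hpos : ∀ ρ ∈ Icc r R, 0 < ρ := fun ρ hρ => hr.trans_le hρ.1
  have hderiv : ∀ w, ∀ ρ ∈ Icc r R, HasDerivAt (fun s => φ w - φ (w - s • ω))
      (inner ℝ (∇ φ (w - ρ • ω)) ω) ρ := fun w ρ _ => hasDerivAt_sub_comp_sub_smul hφ w ω ρ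
  have hcont : ∀ w, ContinuousOn (fun ρ : ℝ => inner ℝ (∇ φ (w - ρ • ω)) ω) (Icc r R) := fun w =>
    have := hK.continuous hβ
    by fun_prop
  have hlip : ∀ w, ∀ ρ ∈ Icc r R, |φ w - φ (w - ρ • ω)| ≤ L * ρ := fun w ρ hρ => by
    simpa only [sub_sub_cancel, hnorm ρ (hpos ρ hρ)] using
      abs_sub_le_of_norm_gradient_le hφ hgrad w (w - ρ • ω)
  have hslope : |inner ℝ (∇ φ x) ω| ≤ L :=
    (abs_real_inner_le_norm _ _).trans (by rw [hω, mul_one]; exact hgrad x)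
  have hinc := increment_sub_increment_le hφ hK heq (r • ω)
  rw [hnorm r hr] at hinc
  simp only [mul_sub, mul_contourIntegrand_smul α φ _ hω, heq]
  calc ∫ ρ in r..R, (rayIntegrand α (inner ℝ (∇ φ x) ω) (φ z - φ (z - ρ • ω))
          (inner ℝ (∇ φ (z - ρ • ω)) ω) ρ - rayIntegrand α (inner ℝ (∇ φ x) ω)
          (φ x - φ (x - ρ • ω)) (inner ℝ (∇ φ (x - ρ • ω)) ω) ρ)
      ≤ r ^ (-α) * (((φ z - φ (z - r • ω)) - (φ x - φ (x - r • ω))) / r) :=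
        integral_rayIntegrand_sub_le hα hL hslope hr hrR (hderiv z) (hderiv x) (hcont z) (hcont x)
          (hlip z) (hlip x) fun ρ _ => by linarith [hmax (ρ • ω)]
    _ ≤ r ^ (-α) * (2 * K * r ^ (β : ℝ)) := by
        refine mul_le_mul_of_nonneg_left ?_ (Real.rpow_nonneg hr.le _)
        exact (div_le_iff₀ hr).2 hinc
    _ = 2 * K * r ^ (β - α) := by
        rw [sub_eq_add_neg, Real.rpow_add hr]
        ring

theorem setIntegral_annulus_contourIntegrand_sub_le (hα : -3 ≤ α)
    (hL : (5 + α) * L ^ 2 ≤ 1 + α) (hφ : Differentiable ℝ φ) (hβ : 0 < β)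
    (hK : HolderWith K β (∇ φ)) (hgrad : ∀ y, ‖∇ φ y‖ ≤ L) (heq : ∇ φ z = ∇ φ x)
    (hmax : ∀ y, φ (z - y) - φ (x - y) ≤ φ z - φ x) {r R : ℝ} (hr : 0 < r) (hrR : r ≤ R)
    (hx : IntegrableOn (contourIntegrand α φ x) {y | r < ‖y‖ ∧ ‖y‖ < R})
    (hz : IntegrableOn (contourIntegrand α φ z) {y | r < ‖y‖ ∧ ‖y‖ < R}) :
    (∫ y in {y : Plane | r < ‖y‖ ∧ ‖y‖ < R}, contourIntegrand α φ z y) -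
        ∫ y in {y : Plane | r < ‖y‖ ∧ ‖y‖ < R}, contourIntegrand α φ x y ≤
      2 * K * r ^ (β - α) * (volume : Measure Plane).toSphere.real univ := by
  rw [← integral_sub hz hx]
  refine setIntegral_annulus_le hr.le hrR (hz.sub hx) fun ω hω => ?_
  simpa using integral_ray_contourIntegrand_sub_le hα hL hφ hβ hK hgrad heq hmax hr hrR hω

theorem tendsto_rpow_nhdsGT_zero {s : ℝ} (hs : 0 < s) :
    Tendsto (fun r : ℝ => r ^ s) (𝓝[>] 0) (𝓝 0) := by
  simpa only [Real.zero_rpow hs.ne'] using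
    (Real.continuousAt_rpow_const 0 s (Or.inr hs.le)).tendsto.mono_left nhdsWithin_le_nhds

theorem HasPV.le_of_isMax_increment (hα : -3 ≤ α) (hL : (5 + α) * L ^ 2 ≤ 1 + α)
    (hφ : Differentiable ℝ φ) (hβ : 0 < β) (hαβ : α < β) (hK : HolderWith K β (∇ φ))
    (hgrad : ∀ y, ‖∇ φ y‖ ≤ L) {ξ : Plane} (hmax : ∀ y, φ (y + ξ) - φ y ≤ φ (x + ξ) - φ x)
    {v w : ℝ} (hx : HasPV (contourIntegrand α φ x) v)
    (hξ : HasPV (contourIntegrand α φ (x + ξ)) w) : w ≤ v := by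
  have heq := gradient_eq_of_isMax_increment hφ hmax
  have hmax' : ∀ y, φ (x + ξ - y) - φ (x - y) ≤ φ (x + ξ) - φ x := fun y => by
    simpa only [sub_add_eq_add_sub] using hmax (x - y)
  have hbound : Tendsto
      (fun r : ℝ => 2 * K * r ^ (β - α) * (volume : Measure Plane).toSphere.real univ)
      (𝓝[>] 0) (𝓝 0) := by
    simpa using ((tendsto_rpow_nhdsGT_zero (sub_pos.2 hαβ)).const_mul (2 * K : ℝ)).mul_const
      ((volume : Measure Plane).toSphere.real univ)
  have hsmall : ∀ᶠ p : ℝ × ℝ in 𝓝[>] 0 ×ˢ atTop, p.1 ∈ Ioo (0 : ℝ) 1 ∧ (1 : ℝ) ≤ p.2 :=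
    Filter.Eventually.prod_mk (Ioo_mem_nhdsGT one_pos) (eventually_ge_atTop 1)
  refine sub_nonpos.1 (le_of_tendsto_of_tendsto (hξ.2.sub hx.2) (hbound.comp tendsto_fst) ?_)
  filter_upwards [hsmall] with p hp
  exact setIntegral_annulus_contourIntegrand_sub_le hα hL hφ hβ hK hgrad heq hmax' hp.1.1
    (hp.1.2.le.trans hp.2) (hx.1 _ _ hp.1.1) (hξ.1 _ _ hp.1.1)

end Comparison

section MaximumPrinciple

theorem nonneg_deriv_of_isMaxOn_Icc {p : ℝ → ℝ} {a b s v : ℝ} (hs : s ∈ Ioc a b)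
    (hmax : IsMaxOn p (Icc a b) s) (hp : HasDerivWithinAt p v (Icc a b) s) : 0 ≤ v := by
  have hsegment : segment ℝ s a ⊆ Icc a b := by
    rw [segment_symm, segment_eq_Icc hs.1.le]
    exact Icc_subset_Icc_right hs.2
  have hnonpos := hmax.localize.hasFDerivWithinAt_nonpos hp.hasFDerivWithinAt
    (sub_mem_posTangentConeAt_of_segment_subset hsegment)
  rw [ContinuousLinearMap.toSpanSingleton_apply, smul_eq_mul] at hnonpos
  exact nonneg_of_mul_nonpos_right hnonpos (sub_neg.2 hs.1)

theorem tendsto_iSup_of_tendstoUniformly {ι X : Type*} [Nonempty X] {l : Filter ι}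
    {q : ι → X → ℝ} {g : X → ℝ} (hg : BddAbove (range g)) (hq : TendstoUniformly q g l) :
    Tendsto (fun i => ⨆ x, q i x) l (𝓝 (⨆ x, g x)) := by
  refine Metric.tendsto_nhds.2 fun ε hε => ?_
  filter_upwards [Metric.tendstoUniformly_iff.1 hq (ε / 2) (half_pos hε)] with i hi
  have hclose : ∀ x, |g x - q i x| < ε / 2 := hi
  have hqi : ∀ x, q i x ≤ (⨆ y, g y) + ε / 2 := fun x => by
    linarith [(abs_lt.1 (hclose x)).1, le_ciSup hg x]
  have hupper : ⨆ x, q i x ≤ (⨆ x, g x) + ε / 2 := ciSup_le hqi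
  have hlower : ⨆ x, g x ≤ (⨆ x, q i x) + ε / 2 := ciSup_le fun x => by
    linarith [(abs_lt.1 (hclose x)).2, le_ciSup ⟨_, forall_mem_range.2 hqi⟩ x]
  rw [Real.dist_eq, abs_lt]
  constructor <;> linarith

variable {X : Type*} [TopologicalSpace X]

theorem exists_forall_ge_of_tendsto_cocompact_zero {g : X → ℝ} (hg : Continuous g)
    (h0 : Tendsto g (cocompact X) (𝓝 0)) {x : X} (hx : 0 < g x) : ∃ z, ∀ y, g y ≤ g z :=
  hg.exists_forall_ge' x ((h0.eventually (gt_mem_nhds hx)).mono fun _ => le_of_lt)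

theorem bddAbove_range_of_tendsto_cocompact_zero {g : X → ℝ} (hg : Continuous g)
    (h0 : Tendsto g (cocompact X) (𝓝 0)) : BddAbove (range g) := by
  by_cases! hpos : ∃ x, 0 < g x
  · obtain ⟨z, hz⟩ := exists_forall_ge_of_tendsto_cocompact_zero hg h0 hpos.choose_spec
    exact ⟨g z, forall_mem_range.2 hz⟩
  · exact ⟨0, forall_mem_range.2 hpos⟩

variable {q : ℝ → X → ℝ} {a b M : ℝ}

theorem le_add_mul_of_deriv_nonpos_at_max (hq : ∀ t ∈ Icc a b, Continuous (q t))
    (h0 : ∀ t ∈ Icc a b, Tendsto (q t) (cocompact X) (𝓝 0))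
    (hunif : ∀ t ∈ Icc a b, TendstoUniformly q (q t) (𝓝[Icc a b] t))
    (hd : ∀ t ∈ Ioc a b, ∀ x, (∀ y, q t y ≤ q t x) →
      ∃ v ≤ 0, HasDerivWithinAt (fun s => q s x) v (Icc a b) t)
    (hM : 0 ≤ M) (ha : ∀ x, q a x ≤ M) {t : ℝ} (ht : t ∈ Icc a b) (x : X) {η : ℝ} (hη : 0 < η) :
    q t x ≤ M + η * (t - a) := by
  have : Nonempty X := ⟨x⟩
  have hbdd : ∀ s ∈ Icc a b, BddAbove (range (q s)) := fun s hs =>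
    bddAbove_range_of_tendsto_cocompact_zero (hq s hs) (h0 s hs)
  have hcont : ContinuousOn (fun s => (⨆ y, q s y) - η * (s - a)) (Icc a b) :=
    ContinuousOn.sub (fun s hs => tendsto_iSup_of_tendstoUniformly (hbdd s hs) (hunif s hs))
      (by fun_prop)
  obtain ⟨s, hs, hsmax⟩ := isCompact_Icc.exists_isMaxOn ⟨t, ht⟩ hcont
  have hmax : ∀ r ∈ Icc a b, ∀ y, q r y - η * (r - a) ≤ (⨆ y, q s y) - η * (s - a) :=
    fun r hr y => (sub_le_sub_right (le_ciSup (hbdd r hr) y) _).trans (hsmax hr)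
  have hηs : 0 ≤ η * (s - a) := mul_nonneg hη.le (sub_nonneg.2 hs.1)
  suffices hsM : ⨆ y, q s y ≤ M by linarith [hmax t ht x]
  by_contra! hlt
  obtain ⟨y, hy⟩ := exists_lt_of_lt_ciSup hlt
  obtain ⟨z, hz⟩ := exists_forall_ge_of_tendsto_cocompact_zero (hq s hs) (h0 s hs)
    (hM.trans_lt hy)
  have hsup : ⨆ y, q s y = q s z := le_antisymm (ciSup_le hz) (le_ciSup (hbdd s hs) z)
  have hs' : s ∈ Ioc a b := by
    refine ⟨hs.1.lt_of_ne ?_, hs.2⟩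
    rintro rfl
    linarith [ha z]
  obtain ⟨v, hv, hderiv⟩ := hd s hs' z hz
  have hslope := nonneg_deriv_of_isMaxOn_Icc hs' (fun r hr => (hmax r hr z).trans_eq (by rw [hsup]))
    (hderiv.sub (((hasDerivWithinAt_id s (Icc a b)).sub_const a).const_mul η))
  linarith

theorem le_of_deriv_nonpos_at_max (hq : ∀ t ∈ Icc a b, Continuous (q t))
    (h0 : ∀ t ∈ Icc a b, Tendsto (q t) (cocompact X) (𝓝 0))
    (hunif : ∀ t ∈ Icc a b, TendstoUniformly q (q t) (𝓝[Icc a b] t))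
    (hd : ∀ t ∈ Ioc a b, ∀ x, (∀ y, q t y ≤ q t x) →
      ∃ v ≤ 0, HasDerivWithinAt (fun s => q s x) v (Icc a b) t)
    (hM : 0 ≤ M) (ha : ∀ x, q a x ≤ M) {t : ℝ} (ht : t ∈ Icc a b) (x : X) : q t x ≤ M := by
  have hlim : Tendsto (fun η => M + η * (t - a)) (𝓝[>] 0) (𝓝 M) := by
    have hcont : Continuous fun η : ℝ => M + η * (t - a) := by fun_prop
    simpa using (hcont.tendsto 0).mono_left nhdsWithin_le_nhds
  refine ge_of_tendsto hlim ?_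
  filter_upwards [self_mem_nhdsWithin] with η hη
  exact le_add_mul_of_deriv_nonpos_at_max hq h0 hunif hd hM ha ht x hη

end MaximumPrinciple

section Increment

variable {α T : ℝ} {k : ℕ} {f₀ : Plane → ℝ} {f : ℝ → Plane → ℝ}

theorem IsSolution.increment_le (hf : IsSolution α k T f₀ f) (hk : 3 ≤ k) (hα : -3 ≤ α)
    (hα₁ : α < 1) {a b L M : ℝ} (hab : Icc a b ⊆ Icc 0 T) (hL : (5 + α) * L ^ 2 ≤ 1 + α)
    (hgrad : ∀ t ∈ Icc a b, ∀ x, ‖∇ (f t) x‖ ≤ L) {ξ : Plane} (hM : 0 ≤ M)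
    (ha : ∀ x, f a (x + ξ) - f a x ≤ M) {t : ℝ} (ht : t ∈ Icc a b) (x : Plane) :
    f t (x + ξ) - f t x ≤ M := by
  obtain ⟨β, hαβ, hβ⟩ := exists_between (max_lt hα₁ one_pos)
  lift β to NNReal using (le_max_right α 0).trans hαβ.le
  refine le_of_deriv_nonpos_at_max (q := fun t x => f t (x + ξ) - f t x)
    (fun t ht => ?_) (fun t ht => ?_) (fun t ht => ?_) (fun t ht x hmax => ?_) hM ha ht x
  · have := hf.continuous t (hab ht)
    fun_prop
  · have hdecay := hf.tendsto_cocompact (by lia) (hab ht)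
    simpa using
      (hdecay.comp (Homeomorph.addRight ξ).isClosedEmbedding.tendsto_cocompact).sub hdecay
  · have hunif := hf.tendstoUniformly (by lia) (hab ht)
    exact fun u hu =>
      ((hunif.comp (· + ξ)).fun_sub hunif u hu).filter_mono (nhdsWithin_mono t hab)
  · have hab_t := hab (Ioc_subset_Icc_self ht)
    obtain ⟨K, hK⟩ := hf.exists_holderWith_gradient hk hab_t (by exact_mod_cast hβ)
    obtain ⟨v, hv, hpv⟩ := hf.equation t hab_t x
    obtain ⟨w, hw, hpw⟩ := hf.equation t hab_t (x + ξ)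
    refine ⟨w - v, sub_nonpos.2 ?_, (hw.sub hv).mono hab⟩
    exact hpv.le_of_isMax_increment hα hL (hf.differentiable hk hab_t)
      (by exact_mod_cast (le_max_right α 0).trans_lt hαβ) ((le_max_left α 0).trans_lt hαβ) hK
      (hgrad t (Ioc_subset_Icc_self ht)) hmax hpw

end Increment

theorem exists_gt_mul_sq_le {c d L : ℝ} (h : c * L ^ 2 < d) : ∃ Λ > L, c * Λ ^ 2 ≤ d := by
  have hcont : ContinuousAt (fun l : ℝ => c * l ^ 2) L := by fun_prop
  have hev : ∀ᶠ l in 𝓝[>] L, c * l ^ 2 < d :=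
    nhdsWithin_le_nhds (hcont.eventually (gt_mem_nhds h))
  obtain ⟨Λ, hΛ, hLΛ⟩ := (hev.and self_mem_nhdsWithin).exists
  exact ⟨Λ, hLΛ, hΛ.le⟩

section Continuation

variable {α T L : ℝ} {k : ℕ} {f₀ : Plane → ℝ} {f : ℝ → Plane → ℝ}

theorem IsSolution.isClosed_norm_gradient_le (hf : IsSolution α k T f₀ f) (hk : 3 ≤ k) (L : ℝ) :
    IsClosed ({t | ∀ x, ‖∇ (f t) x‖ ≤ L} ∩ Icc 0 T) := by
  refine isClosed_of_closure_subset fun t ht => ?_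
  have htT : t ∈ Icc 0 T := closure_minimal inter_subset_right isClosed_Icc ht
  refine ⟨fun x => ?_, htT⟩
  have := mem_closure_iff_nhdsWithin_neBot.1 ht
  have hlim : Tendsto (fun s => ‖∇ (f s) x‖) (𝓝[{t | ∀ x, ‖∇ (f t) x‖ ≤ L} ∩ Icc 0 T] t)
      (𝓝 ‖∇ (f t) x‖) :=
    ((hf.tendstoUniformly_gradient hk htT).tendsto_at x).norm.mono_left
      (nhdsWithin_mono t inter_subset_right)
  refine le_of_tendsto hlim ?_
  filter_upwards [self_mem_nhdsWithin] with s hs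
  exact hs.1 x

theorem IsSolution.exists_gt_forall_norm_gradient_le (hf : IsSolution α k T f₀ f) (hk : 3 ≤ k)
    {Λ t : ℝ} (hLΛ : L < Λ) (ht : t ∈ Ico 0 T) (htL : ∀ x, ‖∇ (f t) x‖ ≤ L) :
    ∃ b > t, b ≤ T ∧ ∀ s ∈ Icc t b, ∀ x, ‖∇ (f s) x‖ ≤ Λ := by
  have hev : ∀ᶠ s in 𝓝[≥] t, ∀ x, dist (∇ (f t) x) (∇ (f s) x) < Λ - L := by
    rw [← nhdsWithin_Icc_eq_nhdsGE ht.2]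
    exact (Metric.tendstoUniformly_iff.1 (hf.tendstoUniformly_gradient hk ⟨ht.1, ht.2.le⟩) _
      (sub_pos.2 hLΛ)).filter_mono (nhdsWithin_mono t (Icc_subset_Icc_left ht.1))
  obtain ⟨b, htb, hsub⟩ :=
    mem_nhdsGE_iff_exists_Icc_subset.1 (inter_mem hev (Icc_mem_nhdsGE ht.2))
  refine ⟨b, htb, (hsub (right_mem_Icc.2 (le_of_lt htb))).2.2, fun s hs x => ?_⟩
  have hdist : dist (∇ (f t) x) (∇ (f s) x) < Λ - L := (hsub hs).1 x
  rw [dist_eq_norm] at hdist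
  linarith [norm_le_norm_add_norm_sub (∇ (f t) x) (∇ (f s) x), htL x]

theorem IsSolution.norm_gradient_le_of_left (hf : IsSolution α k T f₀ f) (hk : 3 ≤ k)
    (hα : -3 ≤ α) (hα₁ : α < 1) {a b Λ : ℝ} (hab : Icc a b ⊆ Icc 0 T) (hL : 0 ≤ L)
    (hΛ : (5 + α) * Λ ^ 2 ≤ 1 + α) (hgrad : ∀ t ∈ Icc a b, ∀ x, ‖∇ (f t) x‖ ≤ Λ)
    (ha : ∀ x, ‖∇ (f a) x‖ ≤ L) {t : ℝ} (ht : t ∈ Icc a b) (x : Plane) : ‖∇ (f t) x‖ ≤ L := by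
  have hdiff := hf.differentiable hk (hab (left_mem_Icc.2 (ht.1.trans ht.2)))
  refine norm_gradient_le_of_increment_le hL (fun ξ x => ?_) x
  refine hf.increment_le hk hα hα₁ hab hΛ hgrad (by positivity) (fun y => ?_) ht x
  simpa using (le_abs_self _).trans (abs_sub_le_of_norm_gradient_le hdiff ha (y + ξ) y)

theorem IsSolution.norm_gradient_le (hf : IsSolution α k T f₀ f) (hk : 3 ≤ k) (hα : -3 ≤ α)
    (hα₁ : α < 1) (hL : 0 ≤ L) (hlt : (5 + α) * L ^ 2 < 1 + α) (h0 : ∀ x, ‖∇ f₀ x‖ ≤ L) {t : ℝ}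
    (ht : t ∈ Icc 0 T) : ∀ x, ‖∇ (f t) x‖ ≤ L := by
  obtain ⟨Λ, hLΛ, hΛ⟩ := exists_gt_mul_sq_le hlt
  refine IsClosed.Icc_subset_of_forall_exists_gt (hf.isClosed_norm_gradient_le hk L)
    (by simpa only [mem_ofPred_eq, hf.initial] using h0) ?_ ht
  rintro t ⟨htL, htT⟩ y hy
  obtain ⟨b, htb, hbT, hb⟩ := hf.exists_gt_forall_norm_gradient_le hk hLΛ htT htL
  have htmin : t < min b y := lt_min htb hy
  refine ⟨min b y, fun x => ?_, htmin, min_le_right b y⟩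
  exact hf.norm_gradient_le_of_left hk hα hα₁ (Icc_subset_Icc htT.1 hbT) hL hΛ hb htL
    ⟨htmin.le, min_le_left b y⟩ x

end Continuation

theorem eLpNorm_top_le_ofReal_iff {X E : Type*} [TopologicalSpace X] [MeasurableSpace X]
    [NormedAddCommGroup E] {μ : Measure X} [μ.IsOpenPosMeasure] {g : X → E} (hg : Continuous g)
    {L : ℝ} (hL : 0 ≤ L) : eLpNorm g ⊤ μ ≤ ENNReal.ofReal L ↔ ∀ x, ‖g x‖ ≤ L := by
  have hbound : ∀ x, ‖g x‖ₑ ≤ ENNReal.ofReal L ↔ ‖g x‖ ≤ L := fun x => by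
    rw [← ofReal_norm, ENNReal.ofReal_le_ofReal_iff hL]
  simp only [← hbound, eLpNorm_exponent_top]
  refine ⟨fun h => ?_, fun h => eLpNormEssSup_le_of_ae_enorm_bound (ae_of_all _ h)⟩
  have hdense : Dense {x | ‖g x‖ₑ ≤ ENNReal.ofReal L} :=
    Measure.dense_of_ae ((enorm_ae_le_eLpNormEssSup g μ).mono fun _ hx => hx.trans h)
  have hclosed : IsClosed {x | ‖g x‖ₑ ≤ ENNReal.ofReal L} := isClosed_le hg.enorm continuous_const
  exact eq_univ_iff_forall.1 (hclosed.closure_eq.symm.trans hdense.closure_eq)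

theorem mul_sq_lt_of_ofReal_lt_ofReal_sqrt_div {c d L : ℝ} (hc : 0 < c) (hL : 0 ≤ L)
    (h : ENNReal.ofReal L < ENNReal.ofReal (√(d / c))) : c * L ^ 2 < d := by
  rw [ENNReal.ofReal_lt_ofReal_iff_of_nonneg hL, Real.lt_sqrt hL, lt_div_iff₀ hc] at h
  linarith

end Muskat

theorem mainTheorem5_general (k : ℕ) (hk : 3 ≤ k) (f₀ : Muskat.Plane → ℝ) (α : ℝ)
    (hα₀ : -1 < α) (hα₁ : α < 1) (T : ℝ) (f : ℝ → Muskat.Plane → ℝ)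
    (hf : Muskat.IsSolution α k T f₀ f)
    (hsmall : eLpNorm (∇ f₀) ⊤ volume < ENNReal.ofReal (√((1 + α) / (5 + α)))) :
    ∀ t ∈ Icc 0 T, eLpNorm (∇ (f t)) ⊤ volume ≤ eLpNorm (∇ f₀) ⊤ volume := by
  intro t ht
  obtain ⟨L, hL, hL₀⟩ : ∃ L : ℝ, 0 ≤ L ∧ ENNReal.ofReal L = eLpNorm (∇ f₀) ⊤ volume :=
    ⟨_, ENNReal.toReal_nonneg, ENNReal.ofReal_toReal hsmall.ne_top⟩
  rw [← hL₀] at hsmall ⊢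
  have hlt := Muskat.mul_sq_lt_of_ofReal_lt_ofReal_sqrt_div (by linarith) hL hsmall
  have hcont₀ : Continuous (∇ f₀) :=
    hf.initial ▸ hf.continuous_gradient hk (left_mem_Icc.2 (ht.1.trans ht.2))
  refine (Muskat.eLpNorm_top_le_ofReal_iff (hf.continuous_gradient hk ht) hL).2 ?_
  exact hf.norm_gradient_le hk (by linarith) hα₁ hL hlt
    ((Muskat.eLpNorm_top_le_ofReal_iff hcont₀ hL).1 hL₀.ge) ht

theorem mainTheorem5 (k : ℕ) (hk : 4 ≤ k) (f₀ : Muskat.Plane → ℝ) (hf₀ : Muskat.MemH k f₀)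
    (α : ℝ) (hα₀ : 0 ≤ α) (hα₁ : α < 1) (ε : ℝ) (hε₀ : 0 < ε) (hε₁ : ε < 1 + α)
    (T : ℝ) (hT : 0 < T) (f : ℝ → Muskat.Plane → ℝ) (hf : Muskat.IsSolution α k T f₀ f)
    (hsmall : eLpNorm (∇ f₀) ⊤ volume
      < ENNReal.ofReal (Real.sqrt ((1 + α - ε) / (5 + α + ε)))) :
    ∀ t ∈ Icc 0 T, eLpNorm (∇ (f t)) ⊤ volume ≤ eLpNorm (∇ f₀) ⊤ volume := by
  have hthreshold : (1 + α - ε) / (5 + α + ε) ≤ (1 + α) / (5 + α) :=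
    div_le_div₀ (by linarith) (by linarith) (by linarith) (by linarith)
  exact mainTheorem5_general k (by lia) f₀ α (by linarith) hα₁ T f hf
    (hsmall.trans_le (ENNReal.ofReal_le_ofReal (Real.sqrt_le_sqrt hthreshold)))
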